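/- Let $R$ be a ring with identity (not necessarily commutative); all modules are left and unitary. Let $\mathcal S$ be a class of finitely presented $R$-modules with $R\in\mathcal S$ which is set-presentable, i.e. there is a set $\mathcal S^*\subseteq\mathcal S$ such that every $U\in\mathcal S$ is isomorphic to some $U^*\in\mathcal S^*$. An exact sequence $0\to A\to B\to C\to 0$ of $R$-modules is called $\mathcal S$-pure if $\operatorname{Hom}_R(U,B)\to\operatorname{Hom}_R(U,C)$ is surjective for all $U\in\mathcal S$. A module $P$ (resp. $E$) is $\mathcal S$-pure projective (resp. $\mathcal S$-pure injective) if for each $\mathcal S$-pure exact sequence $0\to A\to B\to C\to 0$ the map $\operatorname{Hom}_R(P,B)\to\operatorname{Hom}_R(P,C)$ (resp. $\operatorname{Hom}_R(B,E)\to\operatorname{Hom}_R(A,E)$) is surjective. Let $\mathcal{SP}$ and $\mathcal{SI}$ denote the classes of all $\mathcal S$-pure projective and all $\mathcal S$-pure injective $R$-modules. For classes $\mathcal F,\mathcal G$ of $R$-modules, the functor $\operatorname{Hom}_R(-,\sim)$ is right balanced by $\mathcal F\times\mathcal G$ if for each $R$-module $M$ there are complexes $$\mathbf F_\bullet=\cdots\to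 F_n\to\cdots\to F_0\to M\to 0,\qquad \mathbf G^\bullet=0\to M\to G^0\to\cdots\to G^n\to\cdots$$ with $F_n\in\mathcal F$ and $G^n\in\mathcal G$ for all $n\ge 0$, such that the complexes $\operatorname{Hom}_R(\mathbf F_\bullet,G)$ and $\operatorname{Hom}_R(F,\mathbf G^\bullet)$ are exact for all $F\in\mathcal F$ and $G\in\mathcal G$. A long exact sequence is $\mathcal S$-pure if all the short exact sequences $0\to\operatorname{Ker}\to X\to\operatorname{Im}\to 0$ into which it decomposes are $\mathcal S$-pure. The length of a resolution $\cdots\to X_1\to X_0\to M\to 0$ or $0\to M\to X_0\to X_1\to\cdots$ is the least $n\ge 0$ with $X_k=0$ for all $k>n$ ($\infty$ if there is none). The $\mathcal S$-pure projective dimension of $M$ is the infimum of the lengths of the $\mathcal S$-pure exact left resolutions of $M$ by $\mathcal S$-pure projective modules, and the $\mathcal S$-pure injective dimension of $M$ is the infimum of the lengths of the $\mathcal S$-pure exact right resolutions of $M$ by $\mathcal S$-pure injective modules. The left global $\mathcal S$-pure projective (resp. injective) dimension of $R$ is the supremum in $\mathbb N\cup\{\infty\}$ of the $\mathcal S$-pure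 projective (resp. injective) dimensions of all $R$-modules. Then $\operatorname{Hom}_R(-,\sim)$ is right balanced by $\mathcal{SP}\times\mathcal{SI}$. In particular, the left global $\mathcal S$-pure projective dimension of $R$ is equal to its left global $\mathcal S$-pure injective dimension. -/

import Mathlib

/-! Relative purity of modules.

`R` is a ring with identity, not necessarily commutative; modules are left and unitary, and are
taken in the universe of `R`.  A class of modules is a `Set (ModuleCat.{u} R)`, not assumed to be
closed under isomorphism. -/

universe u

namespace RelPurity

section Purity

variable {R : Type u} [Ring R]

/-- The class `S` has a (small) subset `T` such that every member of `S` is isomorphic to a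
member of `T`. -/
def SetPresentable (S : Set (ModuleCat.{u} R)) : Prop :=
  ∃ T : Set (ModuleCat.{u} R), Small.{u} T ∧ T ⊆ S ∧
    ∀ U ∈ S, ∃ V ∈ T, Nonempty (V ≃ₗ[R] U)

/-- `0 → A → B → C → 0` is an `S`-pure exact sequence: it is exact, and
`Hom(U, B) → Hom(U, C)` is surjective for all `U ∈ S`. -/
def IsPureExact (S : Set (ModuleCat.{u} R)) {A B C : Type u}
    [AddCommGroup A] [Module R A] [AddCommGroup B] [Module R B] [AddCommGroup C] [Module R C]
    (f : A →ₗ[R] B) (g : B →ₗ[R] C) : Prop :=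
  Function.Injective f ∧ Function.Exact f g ∧ Function.Surjective g ∧
    ∀ U ∈ S, Function.Surjective (fun k : U →ₗ[R] B => g ∘ₗ k)

/-- `P` is `S`-pure projective: `Hom(P, B) → Hom(P, C)` is surjective for every `S`-pure exact
sequence `0 → A → B → C → 0`. -/
def IsPureProjective (S : Set (ModuleCat.{u} R)) (P : Type u) [AddCommGroup P] [Module R P] :
    Prop :=
  ∀ (A B C : Type u) [AddCommGroup A] [Module R A] [AddCommGroup B] [Module R B]
    [AddCommGroup C] [Module R C] (f : A →ₗ[R] B) (g : B →ₗ[R] C),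
    IsPureExact S f g → Function.Surjective (fun k : P →ₗ[R] B => g ∘ₗ k)

/-- `E` is `S`-pure injective: `Hom(B, E) → Hom(A, E)` is surjective for every `S`-pure exact
sequence `0 → A → B → C → 0`. -/
def IsPureInjective (S : Set (ModuleCat.{u} R)) (E : Type u) [AddCommGroup E] [Module R E] :
    Prop :=
  ∀ (A B C : Type u) [AddCommGroup A] [Module R A] [AddCommGroup B] [Module R B]
    [AddCommGroup C] [Module R C] (f : A →ₗ[R] B) (g : B →ₗ[R] C),
    IsPureExact S f g → Function.Surjective (fun k : B →ₗ[R] E => k ∘ₗ f)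

/-- The class of all `S`-pure projective modules. -/
def pureProjectives (S : Set (ModuleCat.{u} R)) : Set (ModuleCat.{u} R) :=
  {P | IsPureProjective S P}

/-- The class of all `S`-pure injective modules. -/
def pureInjectives (S : Set (ModuleCat.{u} R)) : Set (ModuleCat.{u} R) :=
  {E | IsPureInjective S E}

end Purity

section Complexes

variable {R : Type u} [Ring R]

/-- A complex `⋯ → X (n+1) → X n → ⋯ → X 0 → M → 0`. -/
structure LeftComplex (M : ModuleCat.{u} R) where
  X : ℕ → ModuleCat.{u} R
  d : ∀ n, X (n + 1) →ₗ[R] X n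
  aug : X 0 →ₗ[R] M
  aug_comp_d : aug ∘ₗ d 0 = 0
  d_comp_d : ∀ n, d n ∘ₗ d (n + 1) = 0

/-- A complex `0 → M → X 0 → ⋯ → X n → X (n+1) → ⋯`. -/
structure RightComplex (M : ModuleCat.{u} R) where
  X : ℕ → ModuleCat.{u} R
  d : ∀ n, X n →ₗ[R] X (n + 1)
  aug : M →ₗ[R] X 0
  d_comp_aug : d 0 ∘ₗ aug = 0
  d_comp_d : ∀ n, d (n + 1) ∘ₗ d n = 0

/-- The complex `0 → Hom(M, G) → Hom(X 0, G) → Hom(X 1, G) → ⋯` is exact (at every place). -/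
def LeftComplex.HomExact {M : ModuleCat.{u} R} (K : LeftComplex M) (G : ModuleCat.{u} R) : Prop :=
  Function.Injective (fun h : M →ₗ[R] G => h ∘ₗ K.aug) ∧
  Function.Exact (fun h : M →ₗ[R] G => h ∘ₗ K.aug) (fun h : K.X 0 →ₗ[R] G => h ∘ₗ K.d 0) ∧
  ∀ n, Function.Exact (fun h : K.X n →ₗ[R] G => h ∘ₗ K.d n)
    (fun h : K.X (n + 1) →ₗ[R] G => h ∘ₗ K.d (n + 1))

/-- The complex `0 → Hom(F, M) → Hom(F, X 0) → Hom(F, X 1) → ⋯` is exact (at every place). -/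
def RightComplex.HomExact {M : ModuleCat.{u} R} (K : RightComplex M) (F : ModuleCat.{u} R) :
    Prop :=
  Function.Injective (fun h : F →ₗ[R] M => K.aug ∘ₗ h) ∧
  Function.Exact (fun h : F →ₗ[R] M => K.aug ∘ₗ h) (fun h : F →ₗ[R] K.X 0 => K.d 0 ∘ₗ h) ∧
  ∀ n, Function.Exact (fun h : F →ₗ[R] K.X n => K.d n ∘ₗ h)
    (fun h : F →ₗ[R] K.X (n + 1) => K.d (n + 1) ∘ₗ h)

/-- The functor `Hom_R(-, ∼)` is right balanced by `𝓕 × 𝓖`. -/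
def HomRightBalanced (𝓕 𝓖 : Set (ModuleCat.{u} R)) : Prop :=
  ∀ M : ModuleCat.{u} R, ∃ (K : LeftComplex M) (L : RightComplex M),
    (∀ n, K.X n ∈ 𝓕) ∧ (∀ n, L.X n ∈ 𝓖) ∧
    (∀ G ∈ 𝓖, K.HomExact G) ∧ (∀ F ∈ 𝓕, L.HomExact F)

/-- The sequence `0 → Ker f → B → Im f → 0` is `S`-pure exact. -/
def IsPureMap (S : Set (ModuleCat.{u} R)) {B C : Type u}
    [AddCommGroup B] [Module R B] [AddCommGroup C] [Module R C] (f : B →ₗ[R] C) : Prop :=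
  IsPureExact S (LinearMap.ker f).subtype f.rangeRestrict

/-- `⋯ → X 1 → X 0 → M → 0` is a long exact sequence which is `S`-pure, i.e. all the short exact
sequences `0 → Ker → X n → Im → 0` into which it decomposes are `S`-pure. -/
def LeftComplex.IsPureResolution {M : ModuleCat.{u} R} (S : Set (ModuleCat.{u} R))
    (K : LeftComplex M) : Prop :=
  Function.Surjective K.aug ∧ Function.Exact (K.d 0) K.aug ∧
  (∀ n, Function.Exact (K.d (n + 1)) (K.d n)) ∧
  IsPureMap S K.aug ∧ ∀ n, IsPureMap S (K.d n)

/-- `0 → M → X 0 → X 1 → ⋯` is a long exact sequence which is `S`-pure, i.e. all the short exact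
sequences `0 → Ker → X n → Im → 0` into which it decomposes are `S`-pure. -/
def RightComplex.IsPureResolution {M : ModuleCat.{u} R} (S : Set (ModuleCat.{u} R))
    (K : RightComplex M) : Prop :=
  Function.Injective K.aug ∧ Function.Exact K.aug (K.d 0) ∧
  (∀ n, Function.Exact (K.d n) (K.d (n + 1))) ∧
  ∀ n, IsPureMap S (K.d n)

/-- The length of a sequence of modules: the least `n` such that all modules of index `> n`
vanish, and `∞` if there is no such `n`. -/
noncomputable def length (X : ℕ → ModuleCat.{u} R) : ℕ∞ :=
  ⨅ (n : ℕ) (_ : ∀ k, n < k → Subsingleton (X k)), (n : ℕ∞)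

/-- The `S`-pure projective dimension of `M`: the infimum of the lengths of the `S`-pure exact
left resolutions of `M` by `S`-pure projective modules. -/
noncomputable def pureProjectiveDimension (S : Set (ModuleCat.{u} R)) (M : ModuleCat.{u} R) : ℕ∞ :=
  ⨅ (K : LeftComplex M) (_ : K.IsPureResolution S ∧ ∀ n, K.X n ∈ pureProjectives S), length K.X

/-- The `S`-pure injective dimension of `M`: the infimum of the lengths of the `S`-pure exact
right resolutions of `M` by `S`-pure injective modules. -/
noncomputable def pureInjectiveDimension (S : Set (ModuleCat.{u} R)) (M : ModuleCat.{u} R) : ℕ∞ :=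
  ⨅ (K : RightComplex M) (_ : K.IsPureResolution S ∧ ∀ n, K.X n ∈ pureInjectives S), length K.X

end Complexes

/-- The left global `S`-pure projective dimension of `R`. -/
noncomputable def globalPureProjectiveDimension (R : Type u) [Ring R]
    (S : Set (ModuleCat.{u} R)) : ℕ∞ :=
  ⨆ M : ModuleCat.{u} R, pureProjectiveDimension S M

/-- The left global `S`-pure injective dimension of `R`. -/
noncomputable def globalPureInjectiveDimension (R : Type u) [Ring R]
    (S : Set (ModuleCat.{u} R)) : ℕ∞ :=
  ⨆ M : ModuleCat.{u} R, pureInjectiveDimension S M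

end RelPurity

/-! The class `S` has enough pure projective modules, namely the direct sums of members of `S`
(`enoughPureProjectives`), and enough pure injective ones (`enoughPureInjectives`). For the latter,
present `U ∈ S` by a matrix `r` with `m` rows and `n` columns. For a short exact sequence
`0 → A → B → C → 0`, all maps `U → C` lift to `B` if and only if `Aᵐ / r Aⁿ → Bᵐ / r Bⁿ` is
injective (`surjective_postcomp_iff_systemMap`). The functor `B ↦ Bᵐ / r Bⁿ` is the tensor product
with the right module `T` presented by `r`, so the character module `T⁺ = Hom_ℤ(T, ℚ/ℤ)`, which
satisfies `Hom(B, T⁺) = (Bᵐ / r Bⁿ)⁺`, is `S`-pure injective. Since characters separate points, the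
canonical map from `M` to a product of such modules `T⁺`, one factor for each `r` and each character
of `Mᵐ / r Mⁿ`, is an `S`-pure monomorphism. All this is done with tuples and matrices, without
tensor products over the noncommutative ring `R`.

Splicing gives `S`-pure projective and injective resolutions of every module, and these stay exact
under `Hom` into pure injective and from pure projective modules respectively; this is the balance
of `Hom`.

For the dimensions, let `0 → K → P → M → 0` and `0 → A → E → L → 0` be `S`-pure exact with `P` pure
projective and `E` pure injective. A diagram chase shows that the relative `Ext¹(K, A)` vanishes if
and only if `Ext¹(M, L)` does (`extOneVanishes_syzygy_iff_cosyzygy`). Hence the vanishing of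
`Extⁿ⁺¹(M, A)` can be shifted in both variables, `M` has pure projective dimension at most `n` if
and only if `Extⁿ⁺¹(M, A) = 0` for all `A`, and `A` has pure injective dimension at most `n` if and
only if `Extⁿ⁺¹(M, A) = 0` for all `M`. Both global dimensions are therefore at most `n` exactly
when `Extⁿ⁺¹` vanishes on all pairs of modules. -/

namespace RelPurity

/-! ### Factoring linear maps and chasing diagrams with short exact rows -/

section Diagrams

variable {R : Type u} [Ring R]
variable {A B C K P M X : Type u} [AddCommGroup A] [Module R A] [AddCommGroup B] [Module R B]
  [AddCommGroup C] [Module R C] [AddCommGroup K] [Module R K] [AddCommGroup P] [Module R P]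
  [AddCommGroup M] [Module R M] [AddCommGroup X] [Module R X]

theorem exists_comp_eq_of_surjective {g : B →ₗ[R] C} (hg : Function.Surjective g)
    {h : B →ₗ[R] X} (hh : ∀ b, g b = 0 → h b = 0) : ∃ k : C →ₗ[R] X, k ∘ₗ g = h := by
  refine ⟨(LinearMap.ker g).liftQ h (fun b hb => hh b hb) ∘ₗ
    (g.quotKerEquivOfSurjective hg).symm.toLinearMap, ?_⟩
  ext b
  have : (g.quotKerEquivOfSurjective hg).symm (g b) = (LinearMap.ker g).mkQ b := by
    rw [LinearEquiv.symm_apply_eq]; rfl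
  simp only [LinearMap.comp_apply, LinearEquiv.coe_coe, this]
  rfl

theorem exists_comp_eq_of_injective {f : A →ₗ[R] B} (hf : Function.Injective f)
    {h : X →ₗ[R] B} (hh : ∀ x, h x ∈ Set.range f) : ∃ k : X →ₗ[R] A, f ∘ₗ k = h := by
  refine ⟨(LinearEquiv.ofInjective f hf).symm.toLinearMap ∘ₗ
    h.codRestrict (LinearMap.range f) (fun x => hh x), ?_⟩
  ext x
  exact congrArg Subtype.val ((LinearEquiv.ofInjective f hf).apply_symm_apply
    (h.codRestrict (LinearMap.range f) (fun x => hh x) x))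

variable {f : A →ₗ[R] B} {g : B →ₗ[R] C} {i : K →ₗ[R] P} {p : P →ₗ[R] M}

/-- Given short exact rows `A → B → C` and `K → P → M`, every map `M → C` lifts to `B` as soon as
every map `P → C` lifts to `B` and every map `K → A` extends to `P`. -/
theorem surjective_postcomp_of_rows (hf : Function.Injective f) (hfg : Function.Exact f g)
    (hip : Function.Exact i p) (hp : Function.Surjective p)
    (hP : Function.Surjective (fun k : P →ₗ[R] B => g ∘ₗ k))
    (hA : Function.Surjective (fun k : P →ₗ[R] A => k ∘ₗ i)) :
    Function.Surjective (fun k : M →ₗ[R] B => g ∘ₗ k) := by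
  intro u
  obtain ⟨v, hv⟩ := hP (u ∘ₗ p)
  have hv' : ∀ x, g (v x) = u (p x) := fun x => LinearMap.congr_fun hv x
  obtain ⟨w, hw⟩ := exists_comp_eq_of_injective hf (h := v ∘ₗ i) fun x => (hfg _).1 (by
    rw [LinearMap.comp_apply, hv', hip.apply_apply_eq_zero, map_zero])
  obtain ⟨q, hq⟩ := hA w
  obtain ⟨s, hs⟩ := exists_comp_eq_of_surjective hp (h := v - f ∘ₗ q) fun x hx => by
    obtain ⟨y, rfl⟩ := (hip x).1 hx
    have h1 : f (w y) = v (i y) := LinearMap.congr_fun hw y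
    have h2 : q (i y) = w y := LinearMap.congr_fun hq y
    simp [h1, h2]
  refine ⟨s, LinearMap.ext fun m => ?_⟩
  obtain ⟨x, rfl⟩ := hp m
  have h1 : s (p x) = v x - f (q x) := LinearMap.congr_fun hs x
  simp [h1, hv', hfg.apply_apply_eq_zero]

/-- Given short exact rows `A → B → C` and `K → P → M`, every map `K → A` extends to `P` as soon
as every map `K → B` extends to `P` and every map `M → C` lifts to `B`. -/
theorem surjective_precomp_of_rows (hf : Function.Injective f) (hfg : Function.Exact f g)
    (hip : Function.Exact i p) (hp : Function.Surjective p)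
    (hB : Function.Surjective (fun k : P →ₗ[R] B => k ∘ₗ i))
    (hM : Function.Surjective (fun k : M →ₗ[R] B => g ∘ₗ k)) :
    Function.Surjective (fun k : P →ₗ[R] A => k ∘ₗ i) := by
  intro u
  obtain ⟨v, hv⟩ := hB (f ∘ₗ u)
  have hv' : ∀ y, v (i y) = f (u y) := fun x => LinearMap.congr_fun hv x
  obtain ⟨w, hw⟩ := exists_comp_eq_of_surjective hp (h := g ∘ₗ v) fun x hx => by
    obtain ⟨y, rfl⟩ := (hip x).1 hx
    rw [LinearMap.comp_apply, hv', hfg.apply_apply_eq_zero]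
  obtain ⟨q, hq⟩ := hM w
  obtain ⟨s, hs⟩ := exists_comp_eq_of_injective hf (h := v - q ∘ₗ p) fun x => (hfg _).1 (by
    have h1 : w (p x) = g (v x) := LinearMap.congr_fun hw x
    have h2 : g (q (p x)) = w (p x) := LinearMap.congr_fun hq (p x)
    simp [h1, h2])
  refine ⟨s, LinearMap.ext fun y => hf ?_⟩
  have h1 : f (s (i y)) = v (i y) - q (p (i y)) := LinearMap.congr_fun hs (i y)
  simp [h1, hv', hip.apply_apply_eq_zero]

/-- If maps `K → B` extend along `i : K → P` and maps `P → C` lift along `g : B → C`, then maps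
`K → C` lift along `g` if and only if they extend along `i`. -/
theorem surjective_postcomp_iff_surjective_precomp
    (hB : Function.Surjective (fun k : P →ₗ[R] B => k ∘ₗ i))
    (hP : Function.Surjective (fun k : P →ₗ[R] B => g ∘ₗ k)) :
    Function.Surjective (fun k : K →ₗ[R] B => g ∘ₗ k) ↔
      Function.Surjective (fun k : P →ₗ[R] C => k ∘ₗ i) := by
  constructor
  · intro h u
    obtain ⟨v, rfl⟩ := h u
    obtain ⟨w, rfl⟩ := hB v
    exact ⟨g ∘ₗ w, rfl⟩
  · intro h u
    obtain ⟨v, rfl⟩ := h u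
    obtain ⟨w, rfl⟩ := hP v
    exact ⟨w ∘ₗ i, rfl⟩

end Diagrams

/-! ### Relative `Ext`-vanishing and dimension shifting -/

section Vanishing

variable {R : Type u} [Ring R]

/-- Every module is the target of an `S`-pure epimorphism from an `S`-pure projective module. -/
def EnoughPureProjectives (S : Set (ModuleCat.{u} R)) : Prop :=
  ∀ M : ModuleCat.{u} R, ∃ (K P : ModuleCat.{u} R) (i : K →ₗ[R] P) (p : P →ₗ[R] M),
    IsPureExact S i p ∧ IsPureProjective S P

/-- Every module is the source of an `S`-pure monomorphism to an `S`-pure injective module. -/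
def EnoughPureInjectives (S : Set (ModuleCat.{u} R)) : Prop :=
  ∀ A : ModuleCat.{u} R, ∃ (E L : ModuleCat.{u} R) (f : A →ₗ[R] E) (g : E →ₗ[R] L),
    IsPureExact S f g ∧ IsPureInjective S E

/-- `Ext¹(M, A) = 0` relative to the `S`-pure exact sequences, phrased as a lifting property. -/
def ExtOneVanishes (S : Set (ModuleCat.{u} R)) (M A : ModuleCat.{u} R) : Prop :=
  ∀ (B C : ModuleCat.{u} R) (f : A →ₗ[R] B) (g : B →ₗ[R] C),
    IsPureExact S f g → Function.Surjective (fun k : M →ₗ[R] B => g ∘ₗ k)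

/-- `Extⁿ⁺¹(M, A) = 0` relative to the `S`-pure exact sequences, defined through cosyzygies
of `A`. -/
def ExtVanishes (S : Set (ModuleCat.{u} R)) : ℕ → ModuleCat.{u} R → ModuleCat.{u} R → Prop
  | 0, M, A => ExtOneVanishes S M A
  | n + 1, M, A => ∃ (E L : ModuleCat.{u} R) (f : A →ₗ[R] E) (g : E →ₗ[R] L),
      IsPureExact S f g ∧ IsPureInjective S E ∧ ExtVanishes S n M L

variable {S : Set (ModuleCat.{u} R)} {M A K P E L : ModuleCat.{u} R}

theorem isPureProjective_iff_forall_extOneVanishes :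
    IsPureProjective S M ↔ ∀ A, ExtOneVanishes S M A :=
  ⟨fun h A B C f g hfg => h A B C f g hfg, fun h A B C _ _ _ _ _ _ f g hfg =>
    h (.of R A) (.of R B) (.of R C) f g hfg⟩

theorem extOneVanishes_iff_precomp (hI : EnoughPureInjectives S) {i : K →ₗ[R] P} {p : P →ₗ[R] M}
    (hip : IsPureExact S i p) (hP : IsPureProjective S P) :
    ExtOneVanishes S M A ↔ Function.Surjective (fun k : P →ₗ[R] A => k ∘ₗ i) := by
  constructor
  · intro h
    obtain ⟨E, L, f, g, hfg, hE⟩ := hI A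
    exact surjective_precomp_of_rows hfg.1 hfg.2.1 hip.2.1 hip.2.2.1 (hE _ _ _ _ _ hip)
      (h _ _ _ _ hfg)
  · intro h B C f g hfg
    exact surjective_postcomp_of_rows hfg.1 hfg.2.1 hip.2.1 hip.2.2.1 (hP _ _ _ _ _ hfg) h

theorem extOneVanishes_iff_postcomp (hPr : EnoughPureProjectives S) {f : A →ₗ[R] E}
    {g : E →ₗ[R] L} (hfg : IsPureExact S f g) (hE : IsPureInjective S E) :
    ExtOneVanishes S M A ↔ Function.Surjective (fun k : M →ₗ[R] E => g ∘ₗ k) := by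
  refine ⟨fun h => h _ _ _ _ hfg, fun h B C f' g' hfg' => ?_⟩
  obtain ⟨K, P, i, p, hip, hP⟩ := hPr M
  exact surjective_postcomp_of_rows hfg'.1 hfg'.2.1 hip.2.1 hip.2.2.1 (hP _ _ _ _ _ hfg')
    (surjective_precomp_of_rows hfg.1 hfg.2.1 hip.2.1 hip.2.2.1 (hE _ _ _ _ _ hip) h)

theorem isPureInjective_iff_forall_extOneVanishes (hPr : EnoughPureProjectives S)
    (hI : EnoughPureInjectives S) : IsPureInjective S A ↔ ∀ M, ExtOneVanishes S M A := by
  constructor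
  · intro h M
    obtain ⟨K, P, i, p, hip, hP⟩ := hPr M
    exact (extOneVanishes_iff_precomp hI hip hP).2 (h _ _ _ _ _ hip)
  · intro h A' B' C' _ _ _ _ _ _ f' g' hfg'
    obtain ⟨E, L, f, g, hfg, hE⟩ := hI A
    exact surjective_precomp_of_rows hfg.1 hfg.2.1 hfg'.2.1 hfg'.2.2.1 (hE _ _ _ _ _ hfg')
      (h (.of R C') _ _ _ _ hfg)

/-- Balance of the relative `Ext²`: it may be computed from a syzygy of the first variable or from
a cosyzygy of the second one. -/
theorem extOneVanishes_syzygy_iff_cosyzygy (hPr : EnoughPureProjectives S)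
    (hI : EnoughPureInjectives S) {i : K →ₗ[R] P} {p : P →ₗ[R] M} (hip : IsPureExact S i p)
    (hP : IsPureProjective S P) {f : A →ₗ[R] E} {g : E →ₗ[R] L} (hfg : IsPureExact S f g)
    (hE : IsPureInjective S E) : ExtOneVanishes S K A ↔ ExtOneVanishes S M L := by
  rw [extOneVanishes_iff_postcomp hPr hfg hE, extOneVanishes_iff_precomp hI hip hP]
  exact surjective_postcomp_iff_surjective_precomp (hE _ _ _ _ _ hip) (hP _ _ _ _ _ hfg)

theorem extVanishes_succ_iff_syzygy (hPr : EnoughPureProjectives S) (hI : EnoughPureInjectives S)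
    {i : K →ₗ[R] P} {p : P →ₗ[R] M} (hip : IsPureExact S i p) (hP : IsPureProjective S P)
    (n : ℕ) : ExtVanishes S (n + 1) M A ↔ ExtVanishes S n K A := by
  induction n generalizing A with
  | zero =>
    constructor
    · rintro ⟨E, L, f, g, hfg, hE, h⟩
      exact (extOneVanishes_syzygy_iff_cosyzygy hPr hI hip hP hfg hE).2 h
    · intro h
      obtain ⟨E, L, f, g, hfg, hE⟩ := hI A
      exact ⟨E, L, f, g, hfg, hE, (extOneVanishes_syzygy_iff_cosyzygy hPr hI hip hP hfg hE).1 h⟩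
  | succ n ih =>
    constructor
    · rintro ⟨E, L, f, g, hfg, hE, h⟩
      exact ⟨E, L, f, g, hfg, hE, ih.1 h⟩
    · rintro ⟨E, L, f, g, hfg, hE, h⟩
      exact ⟨E, L, f, g, hfg, hE, ih.2 h⟩

theorem extVanishes_succ_iff_cosyzygy (hPr : EnoughPureProjectives S) (hI : EnoughPureInjectives S)
    {f : A →ₗ[R] E} {g : E →ₗ[R] L} (hfg : IsPureExact S f g) (hE : IsPureInjective S E)
    (n : ℕ) : ExtVanishes S (n + 1) M A ↔ ExtVanishes S n M L := by
  induction n generalizing M with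
  | zero =>
    obtain ⟨K, P, i, p, hip, hP⟩ := hPr M
    exact (extVanishes_succ_iff_syzygy hPr hI hip hP 0).trans
      (extOneVanishes_syzygy_iff_cosyzygy hPr hI hip hP hfg hE)
  | succ n ih =>
    obtain ⟨K, P, i, p, hip, hP⟩ := hPr M
    rw [extVanishes_succ_iff_syzygy hPr hI hip hP, ih, extVanishes_succ_iff_syzygy hPr hI hip hP]

/-- `M` has an `S`-pure projective resolution of length at most `n`, in the inductive form: a
syzygy of `M` has one of length at most `n - 1`. -/
def HasPureProjectiveDimensionLE (S : Set (ModuleCat.{u} R)) : ℕ → ModuleCat.{u} R → Prop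
  | 0, M => IsPureProjective S M
  | n + 1, M => ∃ (K P : ModuleCat.{u} R) (i : K →ₗ[R] P) (p : P →ₗ[R] M),
      IsPureExact S i p ∧ IsPureProjective S P ∧ HasPureProjectiveDimensionLE S n K

/-- `A` has an `S`-pure injective resolution of length at most `n`, in the inductive form: a
cosyzygy of `A` has one of length at most `n - 1`. -/
def HasPureInjectiveDimensionLE (S : Set (ModuleCat.{u} R)) : ℕ → ModuleCat.{u} R → Prop
  | 0, A => IsPureInjective S A
  | n + 1, A => ∃ (E L : ModuleCat.{u} R) (f : A →ₗ[R] E) (g : E →ₗ[R] L),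
      IsPureExact S f g ∧ IsPureInjective S E ∧ HasPureInjectiveDimensionLE S n L

theorem hasPureProjectiveDimensionLE_iff (hPr : EnoughPureProjectives S)
    (hI : EnoughPureInjectives S) (n : ℕ) :
    HasPureProjectiveDimensionLE S n M ↔ ∀ A, ExtVanishes S n M A := by
  induction n generalizing M with
  | zero => exact isPureProjective_iff_forall_extOneVanishes
  | succ n ih =>
    constructor
    · rintro ⟨K, P, i, p, hip, hP, h⟩ A
      exact (extVanishes_succ_iff_syzygy hPr hI hip hP n).2 (ih.1 h A)
    · intro h
      obtain ⟨K, P, i, p, hip, hP⟩ := hPr M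
      exact ⟨K, P, i, p, hip, hP, ih.2 fun A =>
        (extVanishes_succ_iff_syzygy hPr hI hip hP n).1 (h A)⟩

theorem hasPureInjectiveDimensionLE_iff (hPr : EnoughPureProjectives S)
    (hI : EnoughPureInjectives S) (n : ℕ) :
    HasPureInjectiveDimensionLE S n A ↔ ∀ M, ExtVanishes S n M A := by
  induction n generalizing A with
  | zero => exact isPureInjective_iff_forall_extOneVanishes hPr hI
  | succ n ih =>
    constructor
    · rintro ⟨E, L, f, g, hfg, hE, h⟩ M
      exact (extVanishes_succ_iff_cosyzygy hPr hI hfg hE n).2 (ih.1 h M)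
    · intro h
      obtain ⟨E, L, f, g, hfg, hE⟩ := hI A
      exact ⟨E, L, f, g, hfg, hE, ih.2 fun M =>
        (extVanishes_succ_iff_cosyzygy hPr hI hfg hE n).1 (h M)⟩

end Vanishing

/-! ### Pure resolutions -/

section Resolutions

variable {R : Type u} [Ring R] {S : Set (ModuleCat.{u} R)}

theorem isPureMap_iff {B C : Type u} [AddCommGroup B] [Module R B] [AddCommGroup C] [Module R C]
    {f : B →ₗ[R] C} : IsPureMap S f ↔
      ∀ U ∈ S, ∀ h : U →ₗ[R] C, (∀ x, h x ∈ Set.range f) → ∃ k : U →ₗ[R] B, f ∘ₗ k = h := by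
  constructor
  · intro hf U hU h hh
    obtain ⟨k, hk⟩ := hf.2.2.2 U hU (h.codRestrict (LinearMap.range f) hh)
    exact ⟨k, LinearMap.ext fun x => congrArg Subtype.val (LinearMap.congr_fun hk x)⟩
  · intro hf
    refine ⟨Subtype.val_injective, fun x => ?_, f.surjective_rangeRestrict, fun U hU h => ?_⟩
    · rw [← LinearMap.mem_ker, LinearMap.ker_rangeRestrict]
      exact ⟨fun hx => ⟨⟨x, hx⟩, rfl⟩, fun ⟨y, hy⟩ => hy ▸ y.2⟩
    · obtain ⟨k, hk⟩ := hf U hU ((LinearMap.range f).subtype ∘ₗ h) fun x => (h x).2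
      exact ⟨k, LinearMap.ext fun x => Subtype.ext (LinearMap.congr_fun hk x)⟩

/-- An exact row `A → B → C` with `A → B` injective and `B → C` surjective is `S`-pure if and only
if `B → C` is an `S`-pure map. -/
theorem IsPureExact.of_isPureMap {A B C : Type u} [AddCommGroup A] [Module R A] [AddCommGroup B]
    [Module R B] [AddCommGroup C] [Module R C] {f : A →ₗ[R] B} {g : B →ₗ[R] C}
    (hf : Function.Injective f) (hfg : Function.Exact f g) (hg : Function.Surjective g)
    (h : IsPureMap S g) : IsPureExact S f g :=
  ⟨hf, hfg, hg, fun U hU k => isPureMap_iff.1 h U hU k fun x => hg (k x)⟩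

theorem IsPureExact.isPureMap_comp {A B C D : Type u} [AddCommGroup A] [Module R A]
    [AddCommGroup B] [Module R B] [AddCommGroup C] [Module R C] [AddCommGroup D] [Module R D]
    {f : A →ₗ[R] B} {g : B →ₗ[R] C} (h : IsPureExact S f g) {j : C →ₗ[R] D}
    (hj : Function.Injective j) : IsPureMap S (j ∘ₗ g) := by
  refine isPureMap_iff.2 fun U hU k hk => ?_
  obtain ⟨l, rfl⟩ := exists_comp_eq_of_injective hj (h := k) fun x => by
    obtain ⟨y, hy⟩ := hk x
    exact ⟨g y, hy⟩
  obtain ⟨m, rfl⟩ := h.2.2.2 U hU l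
  exact ⟨m, rfl⟩

/-- Maps from an `S`-pure projective module lift along an `S`-pure map onto its image. -/
theorem IsPureProjective.exists_comp_eq {F B C : Type u} [AddCommGroup F] [Module R F]
    [AddCommGroup B] [Module R B] [AddCommGroup C] [Module R C] (hF : IsPureProjective S F)
    {f : B →ₗ[R] C} (hf : IsPureMap S f) {h : F →ₗ[R] C} (hh : ∀ x, h x ∈ Set.range f) :
    ∃ k : F →ₗ[R] B, f ∘ₗ k = h := by
  obtain ⟨k, hk⟩ := hF _ _ _ _ _ hf (h.codRestrict (LinearMap.range f) hh)
  exact ⟨k, LinearMap.ext fun x => congrArg Subtype.val (LinearMap.congr_fun hk x)⟩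

/-- If `A → B → C → D` is exact and `C → D` is an `S`-pure map, every map from `B` to an `S`-pure
injective module which vanishes on the image of `A` factors through `B → C`. -/
theorem IsPureInjective.exists_comp_eq {E A B C D : Type u} [AddCommGroup E] [Module R E]
    [AddCommGroup A] [Module R A] [AddCommGroup B] [Module R B] [AddCommGroup C] [Module R C]
    [AddCommGroup D] [Module R D] (hE : IsPureInjective S E) {e : A →ₗ[R] B} {f : B →ₗ[R] C}
    {g : C →ₗ[R] D} (hef : Function.Exact e f) (hfg : Function.Exact f g) (hg : IsPureMap S g)
    {h : B →ₗ[R] E} (hh : h ∘ₗ e = 0) : ∃ k : C →ₗ[R] E, k ∘ₗ f = h := by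
  have hfr (b : B) : f b ∈ LinearMap.ker g := hfg.apply_apply_eq_zero b
  obtain ⟨l, hl⟩ := exists_comp_eq_of_surjective (g := f.codRestrict (LinearMap.ker g) hfr)
    (fun c => by
      obtain ⟨b, hb⟩ := (hfg c).1 c.2
      exact ⟨b, Subtype.ext hb⟩) (h := h) (fun b hb => by
      obtain ⟨a, rfl⟩ := (hef b).1 (congrArg Subtype.val hb)
      exact LinearMap.congr_fun hh a)
  obtain ⟨k, hk⟩ := hE _ _ _ _ _ hg l
  refine ⟨k, ?_⟩
  rw [← hl, ← hk]
  rfl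

/-- The modules of the resolution themselves need not be pure projective. -/
theorem LeftComplex.IsPureResolution.homExact {M G : ModuleCat.{u} R} {K : LeftComplex M}
    (hK : K.IsPureResolution S) (hG : IsPureInjective S G) : K.HomExact G := by
  obtain ⟨haug, h0, hd, paug, pd⟩ := hK
  refine ⟨fun a b hab => LinearMap.ext fun m => ?_, fun h => ⟨fun hh => ?_, ?_⟩, fun n h =>
    ⟨fun hh => ?_, ?_⟩⟩
  · obtain ⟨x, rfl⟩ := haug m
    exact LinearMap.congr_fun hab x
  · refine exists_comp_eq_of_surjective haug fun b hb => ?_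
    obtain ⟨a, rfl⟩ := (h0 b).1 hb
    exact LinearMap.congr_fun hh a
  · rintro ⟨k, rfl⟩
    exact LinearMap.ext fun x => by simp [h0.apply_apply_eq_zero]
  · cases n with
    | zero => exact hG.exists_comp_eq (hd 0) h0 paug hh
    | succ n => exact hG.exists_comp_eq (hd (n + 1)) (hd n) (pd n) hh
  · rintro ⟨k, rfl⟩
    exact LinearMap.ext fun x => by simp [(hd n).apply_apply_eq_zero]

/-- The modules of the resolution themselves need not be pure injective. -/
theorem RightComplex.IsPureResolution.homExact {M F : ModuleCat.{u} R} {K : RightComplex M}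
    (hK : K.IsPureResolution S) (hF : IsPureProjective S F) : K.HomExact F := by
  obtain ⟨haug, h0, hd, pd⟩ := hK
  refine ⟨fun a b hab => LinearMap.ext fun m => haug (LinearMap.congr_fun hab m),
    fun h => ⟨fun hh => ?_, ?_⟩, fun n h => ⟨fun hh => ?_, ?_⟩⟩
  · exact exists_comp_eq_of_injective haug fun x => (h0 _).1 (LinearMap.congr_fun hh x)
  · rintro ⟨k, rfl⟩
    exact LinearMap.ext fun x => by simp [h0.apply_apply_eq_zero]
  · exact hF.exists_comp_eq (pd n) fun x => (hd n _).1 (LinearMap.congr_fun hh x)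
  · rintro ⟨k, rfl⟩
    exact LinearMap.ext fun x => by simp [(hd n).apply_apply_eq_zero]

/-- Iterating syzygies gives `S`-pure projective resolutions. -/
theorem exists_leftComplex (hPr : EnoughPureProjectives S) (M : ModuleCat.{u} R) :
    ∃ K : LeftComplex M, K.IsPureResolution S ∧ ∀ n, IsPureProjective S (K.X n) := by
  choose Ω P i p hip hP using hPr
  let Z : ℕ → ModuleCat.{u} R := fun n => Ω^[n] M
  have hZ (n : ℕ) : Z (n + 1) = Ω (Z n) := Function.iterate_succ_apply' Ω n M
  -- `hZ` is not definitional, so the maps `Z (n + 1) → P (Z n)` are chosen anew with this type.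
  have hj (n : ℕ) : ∃ j : Z (n + 1) →ₗ[R] P (Z n), IsPureExact S j (p (Z n)) := by
    rw [hZ]
    exact ⟨i _, hip _⟩
  choose j hj using hj
  refine ⟨⟨fun n => P (Z n), fun n => j n ∘ₗ p (Z (n + 1)), p (Z 0), ?_, fun n => ?_⟩,
    ⟨(hj 0).2.2.1, fun x => ?_, fun n x => ?_, ?_, fun n => ?_⟩, fun n => hP _⟩
  · exact LinearMap.ext fun x => (hj 0).2.1.apply_apply_eq_zero _
  · exact LinearMap.ext fun x => by simp [(hj (n + 1)).2.1.apply_apply_eq_zero]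
  · change p (Z 0) x = 0 ↔ x ∈ Set.range (j 0 ∘ p (Z 1))
    rw [(hj 1).2.2.1.range_comp]
    exact (hj 0).2.1 x
  · change j n (p (Z (n + 1)) x) = 0 ↔ x ∈ Set.range (j (n + 1) ∘ p (Z (n + 2)))
    rw [(hj (n + 2)).2.2.1.range_comp, ← (hj (n + 1)).2.1 x]
    exact map_eq_zero_iff (j n) (hj n).1
  · exact (hj 0).isPureMap_comp (j := LinearMap.id) Function.injective_id
  · exact (hj (n + 1)).isPureMap_comp (hj n).1

/-- Iterating cosyzygies gives `S`-pure injective resolutions. -/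
theorem exists_rightComplex (hI : EnoughPureInjectives S) (M : ModuleCat.{u} R) :
    ∃ K : RightComplex M, K.IsPureResolution S ∧ ∀ n, IsPureInjective S (K.X n) := by
  choose E C f g hfg hE using hI
  let Z : ℕ → ModuleCat.{u} R := fun n => C^[n] M
  have hZ (n : ℕ) : Z (n + 1) = C (Z n) := Function.iterate_succ_apply' C n M
  -- `hZ` is not definitional, so the maps `E (Z n) → Z (n + 1)` are chosen anew with this type.
  have hq (n : ℕ) : ∃ q : E (Z n) →ₗ[R] Z (n + 1), IsPureExact S (f (Z n)) q := by
    rw [hZ]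
    exact ⟨g _, hfg _⟩
  choose q hq using hq
  refine ⟨⟨fun n => E (Z n), fun n => f (Z (n + 1)) ∘ₗ q n, f (Z 0), ?_, fun n => ?_⟩,
    ⟨(hq 0).1, fun x => ?_, fun n x => ?_, fun n => ?_⟩, fun n => hE _⟩
  · exact LinearMap.ext fun x =>
      (congrArg (f (Z 1)) ((hq 0).2.1.apply_apply_eq_zero x)).trans (map_zero _)
  · exact LinearMap.ext fun x => by simp [(hq (n + 1)).2.1.apply_apply_eq_zero]
  · exact (map_eq_zero_iff (f (Z 1)) (hq 1).1).trans ((hq 0).2.1 x)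
  · change f (Z (n + 2)) (q (n + 1) x) = 0 ↔ x ∈ Set.range (f (Z (n + 1)) ∘ q n)
    rw [(hq n).2.2.1.range_comp, ← (hq (n + 1)).2.1 x]
    exact map_eq_zero_iff (f (Z (n + 2))) (hq (n + 2)).1
  · exact (hq n).isPureMap_comp (hq (n + 1)).1

/-! ### Lengths of resolutions -/

theorem length_le_iff {X : ℕ → ModuleCat.{u} R} {n : ℕ} :
    length X ≤ n ↔ ∀ k, n < k → Subsingleton (X k) := by
  constructor
  · intro h
    by_contra hX
    have : ((n + 1 : ℕ) : ℕ∞) ≤ length X := le_iInf₂ fun m hm => by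
      by_contra hmn
      have hmn : m ≤ n := by
        have := not_le.1 hmn
        norm_cast at this
        omega
      exact hX fun k hk => hm k (hmn.trans_lt hk)
    have := this.trans h
    norm_cast at this
    omega
  · exact fun h => iInf₂_le n h

/-- An infimum in `ℕ∞` is at most `n` if and only if one of its terms is. -/
theorem iInf₂_le_natCast_iff {ι : Sort*} {q : ι → Prop} {l : ι → ℕ∞} {n : ℕ} :
    ⨅ (i) (_ : q i), l i ≤ n ↔ ∃ i, q i ∧ l i ≤ n := by
  constructor
  · intro h
    by_contra! hn
    have : (n : ℕ∞) + 1 ≤ ⨅ (i) (_ : q i), l i := le_iInf₂ fun i hi =>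
      ENat.natCast_add_one_le_iff.2 (hn i hi)
    have := this.trans h
    norm_cast at this
    omega
  · rintro ⟨i, hi, hl⟩
    exact (iInf₂_le i hi).trans hl

theorem IsPureProjective.of_bijective {P M : Type u} [AddCommGroup P] [Module R P]
    [AddCommGroup M] [Module R M] (hP : IsPureProjective S P) {e : P →ₗ[R] M}
    (he : Function.Bijective e) : IsPureProjective S M := by
  intro A B C _ _ _ _ _ _ f g hfg h
  obtain ⟨k, hk⟩ := hP A B C f g hfg (h ∘ₗ e)
  refine ⟨k ∘ₗ (LinearEquiv.ofBijective e he).symm.toLinearMap, LinearMap.ext fun x => ?_⟩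
  obtain ⟨y, rfl⟩ := (LinearEquiv.ofBijective e he).surjective x
  simpa using LinearMap.congr_fun hk y

theorem IsPureInjective.of_bijective {E M : Type u} [AddCommGroup E] [Module R E]
    [AddCommGroup M] [Module R M] (hE : IsPureInjective S E) {e : M →ₗ[R] E}
    (he : Function.Bijective e) : IsPureInjective S M := by
  intro A B C _ _ _ _ _ _ f g hfg h
  obtain ⟨k, hk⟩ := hE A B C f g hfg (e ∘ₗ h)
  refine ⟨(LinearEquiv.ofBijective e he).symm.toLinearMap ∘ₗ k, LinearMap.ext fun x => ?_⟩
  have : k (f x) = LinearEquiv.ofBijective e he (h x) := LinearMap.congr_fun hk x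
  simp [this]

/-- The complex `⋯ → X 1 → X 0 → P → M → 0` spliced from a complex `⋯ → X 1 → X 0 → N → 0` and
maps `N → P → M`. -/
def LeftComplex.cons {M N P : ModuleCat.{u} R} (K : LeftComplex N) (i : N →ₗ[R] P)
    (p : P →ₗ[R] M) (h : p ∘ₗ i = 0) : LeftComplex M where
  X := fun n => Nat.casesOn n P K.X
  d := fun n => match n with
    | 0 => i ∘ₗ K.aug
    | n + 1 => K.d n
  aug := p
  aug_comp_d := by rw [← LinearMap.comp_assoc, h, LinearMap.zero_comp]
  d_comp_d := fun n => match n with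
    | 0 => by
      change (i ∘ₗ K.aug) ∘ₗ K.d 0 = 0
      rw [LinearMap.comp_assoc, K.aug_comp_d, LinearMap.comp_zero]
    | n + 1 => K.d_comp_d n

/-- The complex `0 → M → E → X 0 → X 1 → ⋯` spliced from maps `M → E → N` and a complex
`0 → N → X 0 → X 1 → ⋯`. -/
def RightComplex.cons {M N E : ModuleCat.{u} R} (K : RightComplex N) (f : M →ₗ[R] E)
    (g : E →ₗ[R] N) (h : g ∘ₗ f = 0) : RightComplex M where
  X := fun n => Nat.casesOn n E K.X
  d := fun n => match n with
    | 0 => K.aug ∘ₗ g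
    | n + 1 => K.d n
  aug := f
  d_comp_aug := by
    change (K.aug ∘ₗ g) ∘ₗ f = 0
    rw [LinearMap.comp_assoc, h, LinearMap.comp_zero]
  d_comp_d := fun n => match n with
    | 0 => by
      change K.d 0 ∘ₗ K.aug ∘ₗ g = 0
      rw [← LinearMap.comp_assoc, K.d_comp_aug, LinearMap.zero_comp]
    | n + 1 => K.d_comp_d n

/-- The complex `⋯ → X 2 → X 1 → ker (X 0 → M) → 0` obtained from `⋯ → X 1 → X 0 → M → 0`. -/
def LeftComplex.tail {M : ModuleCat.{u} R} (K : LeftComplex M) :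
    LeftComplex (ModuleCat.of R (LinearMap.ker K.aug)) where
  X := fun n => K.X (n + 1)
  d := fun n => K.d (n + 1)
  aug := (K.d 0).codRestrict (LinearMap.ker K.aug) (LinearMap.congr_fun K.aug_comp_d)
  aug_comp_d := LinearMap.ext fun x => Subtype.ext (LinearMap.congr_fun (K.d_comp_d 0) x)
  d_comp_d := fun n => K.d_comp_d (n + 1)

/-- The complex `0 → im (X 0 → X 1) → X 1 → X 2 → ⋯` obtained from `0 → M → X 0 → X 1 → ⋯`. -/
def RightComplex.tail {M : ModuleCat.{u} R} (K : RightComplex M) :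
    RightComplex (ModuleCat.of R (LinearMap.range (K.d 0))) where
  X := fun n => K.X (n + 1)
  d := fun n => K.d (n + 1)
  aug := (LinearMap.range (K.d 0)).subtype
  d_comp_aug := LinearMap.ext fun ⟨_, x, hx⟩ => by
    subst hx
    exact LinearMap.congr_fun (K.d_comp_d 0) x
  d_comp_d := fun n => K.d_comp_d (n + 1)

theorem LeftComplex.IsPureResolution.cons {M N P : ModuleCat.{u} R} {K : LeftComplex N}
    (hK : K.IsPureResolution S) {i : N →ₗ[R] P} {p : P →ₗ[R] M} (hip : IsPureExact S i p) :
    (K.cons i p hip.2.1.linearMap_comp_eq_zero).IsPureResolution S := by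
  obtain ⟨haug, h0, hd, paug, pd⟩ := hK
  refine ⟨hip.2.2.1, fun x => ?_, fun n => ?_,
    hip.isPureMap_comp (j := LinearMap.id) Function.injective_id, fun n => ?_⟩
  · change p x = 0 ↔ x ∈ Set.range (i ∘ K.aug)
    rw [haug.range_comp]
    exact hip.2.1 x
  · cases n with
    | zero =>
      intro x
      exact (map_eq_zero_iff i hip.1).trans (h0 x)
    | succ n => exact hd n
  · cases n with
    | zero =>
      exact (IsPureExact.of_isPureMap (Subtype.val_injective) (LinearMap.exact_subtype_ker_map _)
        haug paug).isPureMap_comp hip.1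
    | succ n => exact pd n

theorem RightComplex.IsPureResolution.cons {M N E : ModuleCat.{u} R} {K : RightComplex N}
    (hK : K.IsPureResolution S) {f : M →ₗ[R] E} {g : E →ₗ[R] N} (hfg : IsPureExact S f g) :
    (K.cons f g hfg.2.1.linearMap_comp_eq_zero).IsPureResolution S := by
  obtain ⟨haug, h0, hd, pd⟩ := hK
  refine ⟨hfg.1, fun x => (map_eq_zero_iff K.aug haug).trans (hfg.2.1 x), fun n => ?_, fun n => ?_⟩
  · cases n with
    | zero =>
      intro x
      change K.d 0 x = 0 ↔ x ∈ Set.range (K.aug ∘ g)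
      rw [hfg.2.2.1.range_comp]
      exact h0 x
    | succ n => exact hd n
  · cases n with
    | zero => exact hfg.isPureMap_comp haug
    | succ n => exact pd n

theorem LeftComplex.IsPureResolution.tail {M : ModuleCat.{u} R} {K : LeftComplex M}
    (hK : K.IsPureResolution S) : K.tail.IsPureResolution S := by
  obtain ⟨haug, h0, hd, paug, pd⟩ := hK
  refine ⟨fun x => ?_, fun x => ?_, fun n => hd (n + 1), ?_, fun n => pd (n + 1)⟩
  · obtain ⟨y, hy⟩ := (h0 x).1 x.2
    exact ⟨y, Subtype.ext hy⟩
  · exact Subtype.ext_iff.trans (hd 0 x)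
  · refine isPureMap_iff.2 fun U hU h hh => ?_
    obtain ⟨k, hk⟩ := isPureMap_iff.1 (pd 0) U hU ((LinearMap.ker K.aug).subtype ∘ₗ h) fun x => by
      obtain ⟨y, hy⟩ := hh x
      exact ⟨y, congrArg Subtype.val hy⟩
    exact ⟨k, LinearMap.ext fun x => Subtype.ext (LinearMap.congr_fun hk x)⟩

theorem RightComplex.IsPureResolution.tail {M : ModuleCat.{u} R} {K : RightComplex M}
    (hK : K.IsPureResolution S) : K.tail.IsPureResolution S := by
  obtain ⟨haug, h0, hd, pd⟩ := hK
  refine ⟨Subtype.val_injective, fun x => ?_, fun n => hd (n + 1), fun n => pd (n + 1)⟩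
  refine (hd 0 x).trans ⟨fun h => ⟨⟨x, h⟩, rfl⟩, ?_⟩
  rintro ⟨y, rfl⟩
  exact y.2

theorem hasPureProjectiveDimensionLE_of_length_le {M : ModuleCat.{u} R} {n : ℕ}
    {K : LeftComplex M} (hK : K.IsPureResolution S) (hP : ∀ k, IsPureProjective S (K.X k))
    (hn : length K.X ≤ n) : HasPureProjectiveDimensionLE S n M := by
  rw [length_le_iff] at hn
  induction n generalizing M with
  | zero =>
    refine (hP 0).of_bijective (e := K.aug) ⟨(injective_iff_map_eq_zero _).2 fun x hx => ?_, hK.1⟩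
    obtain ⟨y, rfl⟩ := (hK.2.1 x).1 hx
    have := hn 1 one_pos
    rw [Subsingleton.elim y 0, map_zero]
  | succ n ih =>
    exact ⟨_, _, _, _, IsPureExact.of_isPureMap Subtype.val_injective
      (LinearMap.exact_subtype_ker_map _) hK.1 hK.2.2.2.1, hP 0,
      ih hK.tail (fun k => hP (k + 1)) fun k hk => hn (k + 1) (Nat.succ_lt_succ hk)⟩

theorem hasPureInjectiveDimensionLE_of_length_le {M : ModuleCat.{u} R} {n : ℕ}
    {K : RightComplex M} (hK : K.IsPureResolution S) (hE : ∀ k, IsPureInjective S (K.X k))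
    (hn : length K.X ≤ n) : HasPureInjectiveDimensionLE S n M := by
  rw [length_le_iff] at hn
  induction n generalizing M with
  | zero =>
    refine (hE 0).of_bijective (e := K.aug) ⟨hK.1, fun x => (hK.2.1 x).1 ?_⟩
    have := hn 1 one_pos
    exact Subsingleton.elim _ _
  | succ n ih =>
    refine ⟨_, _, K.aug, (K.d 0).rangeRestrict, ⟨hK.1, fun x => ?_,
      (hK.2.2.2 0).2.2⟩, hE 0, ih hK.tail (fun k => hE (k + 1)) fun k hk =>
        hn (k + 1) (Nat.succ_lt_succ hk)⟩
    exact Subtype.ext_iff.trans (hK.2.1 x)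

theorem exists_leftComplex_length_le {M : ModuleCat.{u} R} {n : ℕ}
    (h : HasPureProjectiveDimensionLE S n M) : ∃ K : LeftComplex M,
      (K.IsPureResolution S ∧ ∀ k, IsPureProjective S (K.X k)) ∧ length K.X ≤ n := by
  simp only [length_le_iff]
  induction n generalizing M with
  | zero =>
    refine ⟨⟨fun k => Nat.casesOn k M fun _ => ModuleCat.of R PUnit, fun _ => 0, LinearMap.id,
      rfl, fun _ => rfl⟩, ⟨⟨Function.surjective_id, fun x => ?_, fun n x => ?_, ?_, fun n => ?_⟩,
      fun k => ?_⟩, fun k hk => ?_⟩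
    · exact ⟨fun hx => ⟨0, hx.symm⟩, fun ⟨_, hx⟩ => hx.symm⟩
    · exact ⟨fun _ => ⟨0, rfl⟩, fun _ => rfl⟩
    · exact isPureMap_iff.2 fun U _ k _ => ⟨k, rfl⟩
    · exact isPureMap_iff.2 fun U _ k hk => ⟨0, LinearMap.ext fun x => (hk x).choose_spec⟩
    · cases k with
      | zero => exact h
      | succ k => exact fun A B C _ _ _ _ _ _ f g _ k => ⟨0, LinearMap.ext fun x =>
          (LinearMap.map_zero _).trans (LinearMap.map_zero _).symm⟩
    · cases k with
      | zero => exact absurd hk (lt_irrefl _)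
      | succ k => exact inferInstanceAs (Subsingleton PUnit)
  | succ n ih =>
    obtain ⟨N, P, i, p, hip, hP, h⟩ := h
    obtain ⟨K, ⟨hK, hKP⟩, hn⟩ := ih h
    refine ⟨_, ⟨hK.cons hip, fun k => ?_⟩, fun k hk => ?_⟩
    · cases k with
      | zero => exact hP
      | succ k => exact hKP k
    · cases k with
      | zero => exact absurd hk (Nat.not_lt_zero _)
      | succ k => exact hn k (Nat.lt_of_succ_lt_succ hk)

theorem exists_rightComplex_length_le {M : ModuleCat.{u} R} {n : ℕ}
    (h : HasPureInjectiveDimensionLE S n M) : ∃ K : RightComplex M,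
      (K.IsPureResolution S ∧ ∀ k, IsPureInjective S (K.X k)) ∧ length K.X ≤ n := by
  simp only [length_le_iff]
  induction n generalizing M with
  | zero =>
    refine ⟨⟨fun k => Nat.casesOn k M fun _ => ModuleCat.of R PUnit, fun _ => 0, LinearMap.id,
      rfl, fun _ => rfl⟩, ⟨⟨Function.injective_id, fun x => ?_, fun n x => ?_, fun n => ?_⟩,
      fun k => ?_⟩, fun k hk => ?_⟩
    · exact ⟨fun _ => ⟨x, rfl⟩, fun _ => rfl⟩
    · exact ⟨fun _ => ⟨0, rfl⟩, fun _ => rfl⟩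
    · exact isPureMap_iff.2 fun U _ k hk => ⟨0, LinearMap.ext fun x => (hk x).choose_spec⟩
    · cases k with
      | zero => exact h
      | succ k => exact fun A B C _ _ _ _ _ _ f g _ k => ⟨0, LinearMap.ext fun x => rfl⟩
    · cases k with
      | zero => exact absurd hk (lt_irrefl _)
      | succ k => exact inferInstanceAs (Subsingleton PUnit)
  | succ n ih =>
    obtain ⟨E, L, f, g, hfg, hE, h⟩ := h
    obtain ⟨K, ⟨hK, hKE⟩, hn⟩ := ih h
    refine ⟨_, ⟨hK.cons hfg, fun k => ?_⟩, fun k hk => ?_⟩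
    · cases k with
      | zero => exact hE
      | succ k => exact hKE k
    · cases k with
      | zero => exact absurd hk (Nat.not_lt_zero _)
      | succ k => exact hn k (Nat.lt_of_succ_lt_succ hk)

theorem pureProjectiveDimension_le_iff {M : ModuleCat.{u} R} {n : ℕ} :
    pureProjectiveDimension S M ≤ n ↔ HasPureProjectiveDimensionLE S n M :=
  iInf₂_le_natCast_iff.trans ⟨fun ⟨_, hK, hn⟩ =>
    hasPureProjectiveDimensionLE_of_length_le hK.1 hK.2 hn, exists_leftComplex_length_le⟩

theorem pureInjectiveDimension_le_iff {M : ModuleCat.{u} R} {n : ℕ} :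
    pureInjectiveDimension S M ≤ n ↔ HasPureInjectiveDimensionLE S n M :=
  iInf₂_le_natCast_iff.trans ⟨fun ⟨_, hK, hn⟩ =>
    hasPureInjectiveDimensionLE_of_length_le hK.1 hK.2 hn, exists_rightComplex_length_le⟩

/-- Both global dimensions are at most `n` exactly when the relative `Extⁿ⁺¹` vanishes on all
pairs of modules. -/
theorem globalPureProjectiveDimension_eq (hPr : EnoughPureProjectives S)
    (hI : EnoughPureInjectives S) :
    globalPureProjectiveDimension R S = globalPureInjectiveDimension R S := by
  have key (n : ℕ) : globalPureProjectiveDimension R S ≤ n ↔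
      globalPureInjectiveDimension R S ≤ n := by
    simp only [globalPureProjectiveDimension, globalPureInjectiveDimension, iSup_le_iff,
      pureProjectiveDimension_le_iff, pureInjectiveDimension_le_iff,
      hasPureProjectiveDimensionLE_iff hPr hI, hasPureInjectiveDimensionLE_iff hPr hI]
    exact forall_comm
  exact le_antisymm (WithTop.forall_le_coe_iff_le.1 fun n => (key n).2)
    (WithTop.forall_le_coe_iff_le.1 fun n => (key n).1)

theorem homRightBalanced (hPr : EnoughPureProjectives S) (hI : EnoughPureInjectives S) :
    HomRightBalanced (pureProjectives S) (pureInjectives S) := by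
  intro M
  obtain ⟨K, hK, hKP⟩ := exists_leftComplex hPr M
  obtain ⟨L, hL, hLE⟩ := exists_rightComplex hI M
  exact ⟨K, L, hKP, hLE, fun G hG => hK.homExact hG, fun F hF => hL.homExact hF⟩

end Resolutions

/-! ### Enough pure projective modules -/

section Projectives

variable {R : Type u} [Ring R] {S : Set (ModuleCat.{u} R)}

theorem isPureProjective_of_mem {U : ModuleCat.{u} R} (hU : U ∈ S) : IsPureProjective S U :=
  fun _ _ _ _ _ _ _ _ _ _ _ h => h.2.2.2 U hU

theorem IsPureProjective.directSum {ι : Type u} (V : ι → ModuleCat.{u} R)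
    (hV : ∀ i, IsPureProjective S (V i)) :
    IsPureProjective S (DirectSum ι fun i => V i) := by
  classical
  intro A B C _ _ _ _ _ _ f g hfg h
  choose k hk using fun i => hV i A B C f g hfg (h ∘ₗ DirectSum.lof R ι (fun i => V i) i)
  refine ⟨DirectSum.toModule R ι B k, DirectSum.linearMap_ext R fun i => LinearMap.ext fun x => ?_⟩
  have : g (k i x) = h (DirectSum.lof R ι (fun i => V i) i x) := LinearMap.congr_fun (hk i) x
  simp [this]

/-- The sum of all maps `V → M` with `V` in a set of representatives of `S` is an `S`-pure
epimorphism. -/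
theorem enoughPureProjectives (hset : SetPresentable S) (hR : ModuleCat.of R R ∈ S) :
    EnoughPureProjectives S := by
  classical
  intro M
  obtain ⟨T, _, hTS, hT⟩ := hset
  let V (j : Shrink.{u} T) : ModuleCat.{u} R := ((equivShrink T).symm j).1
  let ι : Type u := Σ j : Shrink.{u} T, V j →ₗ[R] M
  let P : Type u := DirectSum ι fun i => V i.1
  let p : P →ₗ[R] M := DirectSum.toModule R ι M fun i => i.2
  have lift (U : ModuleCat.{u} R) (hU : U ∈ S) (h : U →ₗ[R] M) : ∃ k : U →ₗ[R] P, p ∘ₗ k = h := by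
    obtain ⟨W, hW, ⟨e⟩⟩ := hT U hU
    obtain ⟨j, hj⟩ : ∃ j, V j = W := ⟨equivShrink T ⟨W, hW⟩, by simp [V]⟩
    subst hj
    let i : ι := ⟨j, h ∘ₗ e.toLinearMap⟩
    refine ⟨DirectSum.lof R ι (fun i => V i.1) i ∘ₗ e.symm.toLinearMap, LinearMap.ext fun x => ?_⟩
    change p (DirectSum.lof R ι (fun i => V i.1) i (e.symm x)) = h x
    rw [DirectSum.toModule_lof]
    simp [i]
  refine ⟨ModuleCat.of R (LinearMap.ker p), ModuleCat.of R P, (LinearMap.ker p).subtype, p,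
    ⟨Subtype.val_injective, LinearMap.exact_subtype_ker_map p, fun m => ?_, lift⟩,
    IsPureProjective.directSum _ fun i => isPureProjective_of_mem (hTS (Subtype.coe_prop _))⟩
  obtain ⟨k, hk⟩ := lift _ hR (LinearMap.toSpanSingleton R M m)
  exact ⟨k (1 : R), (LinearMap.congr_fun hk (1 : R)).trans (by simp)⟩

end Projectives

/-! ### Extending and separating characters -/

section Characters

theorem exists_addMonoidHom_comp_eq {X Y : Type*} [AddCommGroup X] [AddCommGroup Y] (i : X →+ Y)
    (χ : X →+ AddCircle (1 : ℚ)) (h : ∀ x, i x = 0 → χ x = 0) :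
    ∃ ψ : Y →+ AddCircle (1 : ℚ), ∀ x, ψ (i x) = χ x := by
  let j : X ⧸ i.ker →+ Y := QuotientAddGroup.kerLift i
  obtain ⟨ψ, hψ⟩ := CharacterModule.dual_surjective_of_injective (A := X ⧸ i.ker) (B := Y)
    j.toIntLinearMap (QuotientAddGroup.kerLift_injective i) (QuotientAddGroup.lift i.ker χ h)
  exact ⟨ψ, fun x => DFunLike.congr_fun hψ (x : X ⧸ i.ker)⟩

theorem exists_addMonoidHom_ne_zero {X : Type*} [AddCommGroup X] (N : AddSubgroup X) {x : X}
    (hx : x ∉ N) : ∃ ψ : X →+ AddCircle (1 : ℚ), (∀ y ∈ N, ψ y = 0) ∧ ψ x ≠ 0 := by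
  obtain ⟨c, hc⟩ := CharacterModule.exists_character_apply_ne_zero_of_ne_zero
    (A := X ⧸ N) (a := (x : X ⧸ N)) (by rwa [ne_eq, QuotientAddGroup.eq_zero_iff])
  refine ⟨AddMonoidHom.comp c (QuotientAddGroup.mk' N), fun y hy => ?_, hc⟩
  change c (y : X ⧸ N) = 0
  rw [(QuotientAddGroup.eq_zero_iff y).2 hy]
  exact map_zero (c : X ⧸ N →+ AddCircle (1 : ℚ))

/-- The character group `Hom_ℤ(R, ℚ/ℤ)`, as a left `R`-module through `(s • χ) x = χ (x * s)`. -/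
def RingCharacter (R : Type u) [Ring R] : Type u := R →+ AddCircle (1 : ℚ)

namespace RingCharacter

variable {R : Type u} [Ring R]

instance : AddCommGroup (RingCharacter R) :=
  inferInstanceAs (AddCommGroup (R →+ AddCircle (1 : ℚ)))

instance : FunLike (RingCharacter R) R (AddCircle (1 : ℚ)) :=
  inferInstanceAs (FunLike (R →+ AddCircle (1 : ℚ)) R (AddCircle (1 : ℚ)))

instance : AddMonoidHomClass (RingCharacter R) R (AddCircle (1 : ℚ)) :=
  inferInstanceAs (AddMonoidHomClass (R →+ AddCircle (1 : ℚ)) R (AddCircle (1 : ℚ)))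

@[ext] theorem ext {χ ψ : RingCharacter R} (h : ∀ x, χ x = ψ x) : χ = ψ := DFunLike.ext _ _ h

@[simp] theorem add_apply (χ ψ : RingCharacter R) (x : R) : (χ + ψ) x = χ x + ψ x := rfl

@[simp] theorem zero_apply (x : R) : (0 : RingCharacter R) x = 0 := rfl

/-- Evaluation of characters at an element. -/
def eval (x : R) : RingCharacter R →+ AddCircle (1 : ℚ) where
  toFun χ := χ x
  map_zero' := rfl
  map_add' _ _ := rfl

@[simp] theorem eval_apply (x : R) (χ : RingCharacter R) : eval x χ = χ x := rfl

instance : SMul R (RingCharacter R) := ⟨fun s χ => AddMonoidHom.comp χ (AddMonoidHom.mulRight s)⟩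

@[simp] theorem smul_apply (s : R) (χ : RingCharacter R) (x : R) : (s • χ) x = χ (x * s) := rfl

instance : Module R (RingCharacter R) where
  one_smul χ := by ext x; simp
  mul_smul s t χ := by ext x; simp [mul_assoc]
  smul_zero s := by ext x; simp
  smul_add s χ ψ := by ext x; simp
  add_smul s t χ := by ext x; simp [mul_add]
  zero_smul χ := by ext x; simp

end RingCharacter

end Characters

/-! ### Linear systems and the pure injective modules they define -/

section Systems

variable {R : Type u} [Ring R] {m n : ℕ}

/-- The map `b ↦ r b` from `Bⁿ` to `Bᵐ` given by a matrix `r` over `R`. As `R` need not be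
commutative, it is only additive. -/
def systemMap (r : Fin m → Fin n → R) (B : Type u) [AddCommGroup B] [Module R B] :
    (Fin n → B) →+ (Fin m → B) where
  toFun b i := ∑ j, r i j • b j
  map_zero' := by ext; simp
  map_add' b c := by ext; simp [Finset.sum_add_distrib]

@[simp] theorem systemMap_apply (r : Fin m → Fin n → R) {B : Type u} [AddCommGroup B] [Module R B]
    (b : Fin n → B) (i : Fin m) : systemMap r B b i = ∑ j, r i j • b j := rfl

/-- A matrix `r` is `S`-reflecting if `S`-pure monomorphisms `A → B` reflect the solvability of all
linear systems with left-hand side `r` and constants in `A`. In terms of the right module `T`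
presented by `r`, this says that `T ⊗ A → T ⊗ B` is injective. -/
def IsReflecting (S : Set (ModuleCat.{u} R)) (r : Fin m → Fin n → R) : Prop :=
  ∀ (A B C : ModuleCat.{u} R) (f : A →ₗ[R] B) (g : B →ₗ[R] C), IsPureExact S f g →
    ∀ a : Fin m → A, f ∘ a ∈ (systemMap r B).range → a ∈ (systemMap r A).range

/-- The module of `m`-tuples of characters of `R` annihilating the columns of `r`: this is the
character module of the right module presented by `r`. -/
def characterSolutions (r : Fin m → Fin n → R) : Submodule R (Fin m → RingCharacter R) where
  carrier := {χ | ∀ j x, ∑ i, χ i (r i j * x) = 0}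
  zero_mem' := by simp
  add_mem' {χ ψ} hχ hψ j x := by simp [Finset.sum_add_distrib, hχ j x, hψ j x]
  smul_mem' s χ hχ j x := by simpa [mul_assoc] using hχ j (x * s)

/-- The linear map `B → characterSolutions r` attached to a character of `Bᵐ` annihilating the
image of `r`. -/
def toCharacterSolutions (r : Fin m → Fin n → R) {B : Type u} [AddCommGroup B] [Module R B]
    (ψ : (Fin m → B) →+ AddCircle (1 : ℚ)) (hψ : ∀ b, ψ (systemMap r B b) = 0) :
    B →ₗ[R] characterSolutions r where
  toFun b := ⟨fun i => ((ψ.comp (AddMonoidHom.single (fun _ => B) i)).comp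
      ((smulAddHom R B).flip b) : R →+ AddCircle (1 : ℚ)), fun j x => by
    have h1 : ∑ i, Pi.single i ((r i j * x) • b) = systemMap r B (Pi.single j (x • b)) := by
      ext i
      simp [Finset.sum_apply, Pi.single_apply, mul_smul]
    have h2 := hψ (Pi.single j (x • b))
    rw [← h1, map_sum] at h2
    exact h2⟩
  map_add' b c := by
    ext i x
    change ψ (Pi.single i (x • (b + c))) = ψ (Pi.single i (x • b)) + ψ (Pi.single i (x • c))
    rw [smul_add, Pi.single_add, map_add]
  map_smul' s b := by
    ext i x
    change ψ (Pi.single i (x • s • b)) = ψ (Pi.single i ((x * s) • b))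
    rw [mul_smul]

/-- The character of `Bᵐ` attached to a linear map `B → characterSolutions r`: apply the map to
each component, evaluate the `i`-th character of the `i`-th image at `1`, and sum over `i`. This is
inverse to `toCharacterSolutions`. -/
def evalOne (r : Fin m → Fin n → R) {B : Type u} [AddCommGroup B] [Module R B]
    (k : B →ₗ[R] characterSolutions r) : (Fin m → B) →+ AddCircle (1 : ℚ) where
  toFun b := ∑ i, (k (b i)).1 i 1
  map_zero' := by simp
  map_add' b c := by simp [Finset.sum_add_distrib]

theorem evalOne_systemMap (r : Fin m → Fin n → R) {B : Type u} [AddCommGroup B] [Module R B]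
    (k : B →ₗ[R] characterSolutions r) (b : Fin n → B) : evalOne r k (systemMap r B b) = 0 := by
  have h (i : Fin m) : (k (systemMap r B b i)).1 i 1 = ∑ j, (k (b j)).1 i (r i j) := by
    rw [systemMap_apply, map_sum, ← RingCharacter.eval_apply]
    simp
  change ∑ i, (k (systemMap r B b i)).1 i 1 = 0
  rw [Finset.sum_congr rfl fun i _ => h i, Finset.sum_comm]
  exact Finset.sum_eq_zero fun j _ => by simpa using (k (b j)).2 j 1

theorem evalOne_toCharacterSolutions (r : Fin m → Fin n → R) {B : Type u} [AddCommGroup B]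
    [Module R B] (ψ : (Fin m → B) →+ AddCircle (1 : ℚ)) (hψ : ∀ b, ψ (systemMap r B b) = 0)
    (b : Fin m → B) : evalOne r (toCharacterSolutions r ψ hψ) b = ψ b := by
  change ∑ i, ψ (Pi.single i ((1 : R) • b i)) = ψ b
  simp_rw [one_smul]
  rw [← map_sum, Finset.univ_sum_single]

variable {S : Set (ModuleCat.{u} R)}

theorem IsReflecting.isPureInjective {r : Fin m → Fin n → R} (hr : IsReflecting S r) :
    IsPureInjective S (characterSolutions r) := by
  intro A B C _ _ _ _ _ _ f g hfg k
  -- `T ⊗ A → T ⊗ B` is injective, where `T ⊗ B` is `Bᵐ / r Bⁿ`, so characters extend.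
  obtain ⟨ψ, hψ⟩ := exists_addMonoidHom_comp_eq
    ((QuotientAddGroup.mk' (systemMap r B).range).comp (f.toAddMonoidHom.compLeft (Fin m)))
    (evalOne r k) fun a ha => by
      obtain ⟨a', rfl⟩ := hr (.of R A) (.of R B) (.of R C) f g hfg a
        ((QuotientAddGroup.eq_zero_iff _).1 ha)
      exact evalOne_systemMap r k a'
  refine ⟨toCharacterSolutions r (ψ.comp (QuotientAddGroup.mk' _)) fun b => ?_,
    LinearMap.ext fun a => ?_⟩
  · change ψ ((systemMap r B b : Fin m → B) : (Fin m → B) ⧸ (systemMap r B).range) = 0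
    rw [(QuotientAddGroup.eq_zero_iff _).2
      (show systemMap r B b ∈ (systemMap r B).range from ⟨b, rfl⟩), map_zero]
  · ext i x
    have h1 : evalOne r k (Pi.single i (x • a)) = (k a).1 i x := by
      change ∑ i', (k ((Pi.single i (x • a) : Fin m → A) i')).1 i' 1 = _
      rw [Finset.sum_eq_single i (fun i' _ hi' => by simp [Pi.single_eq_of_ne hi']) (by simp)]
      simp
    rw [← h1, ← hψ]
    change ψ (QuotientAddGroup.mk' _ (Pi.single i (x • f a))) = ψ (QuotientAddGroup.mk' _ _)
    congr 2
    ext i'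
    by_cases hi : i' = i
    · subst hi; simp
    · simp [Pi.single_eq_of_ne hi]

theorem IsPureInjective.pi {ι : Type u} (E : ι → Type u) [∀ i, AddCommGroup (E i)]
    [∀ i, Module R (E i)] (hE : ∀ i, IsPureInjective S (E i)) : IsPureInjective S (∀ i, E i) := by
  intro A B C _ _ _ _ _ _ f g hfg h
  choose k hk using fun i => hE i A B C f g hfg (LinearMap.proj i ∘ₗ h)
  exact ⟨LinearMap.pi k, LinearMap.ext fun a => funext fun i => LinearMap.congr_fun (hk i) a⟩

/-- The system `0 = a` consists of one equation without unknowns, and injective maps reflect its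
solvability. The module it defines is `RingCharacter R`. -/
theorem isReflecting_empty : IsReflecting S (fun (_ : Fin 1) (j : Fin 0) => (j.elim0 : R)) := by
  rintro A B C f g hfg a ⟨b, hb⟩
  refine ⟨0, funext fun i => ?_⟩
  have h1 := congrFun hb i
  simp only [systemMap_apply, Finset.univ_eq_empty, Finset.sum_empty, Function.comp_apply] at h1 ⊢
  exact (hfg.1 (by rw [map_zero, h1]) : (0 : A) = a i)


theorem systemMap_apply_of_linearMap (t : (Fin m → R) →ₗ[R] (Fin n → R)) {B : Type u}
    [AddCommGroup B] [Module R B] (l : (Fin n → R) →ₗ[R] B) (i : Fin m) :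
    systemMap (fun i => t (Pi.single i 1)) B (fun j => l (Pi.single j 1)) i =
      l (t (Pi.single i 1)) := by
  rw [systemMap_apply, l.pi_apply_eq_sum_univ (t (Pi.single i 1))]
  refine Finset.sum_congr rfl fun j _ => ?_
  congr 2
  ext
  simp [Pi.single_apply, eq_comm]

theorem exists_linearMap_single_eq {B : Type u} [AddCommGroup B] [Module R B] (b : Fin n → B) :
    ∃ l : (Fin n → R) →ₗ[R] B, ∀ j, l (Pi.single j 1) = b j :=
  ⟨(Pi.basisFun R (Fin n)).constr ℕ b, fun j => by
    rw [← Pi.basisFun_apply, Module.Basis.constr_basis]⟩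

/-- Let `t` present `U`. For a short exact row `A → B → C`, all maps `U → C` lift to `B` if and
only if `A → B` reflects the solvability of the linear systems given by the matrix of `t`: a lift
to `B` of a map `Rⁿ → U → C` is a solution in `B` of such a system with constants in `A`, and
corrections of this lift to one that factors through `U` are solutions in `A`. -/
theorem surjective_postcomp_iff_systemMap {U A B C : Type u} [AddCommGroup U] [Module R U]
    [AddCommGroup A] [Module R A] [AddCommGroup B] [Module R B] [AddCommGroup C] [Module R C]
    {q : (Fin n → R) →ₗ[R] U} {t : (Fin m → R) →ₗ[R] (Fin n → R)} (hq : Function.Surjective q)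
    (htq : Function.Exact t q) {f : A →ₗ[R] B} {g : B →ₗ[R] C} (hf : Function.Injective f)
    (hfg : Function.Exact f g) (hg : Function.Surjective g) :
    Function.Surjective (fun k : U →ₗ[R] B => g ∘ₗ k) ↔
      ∀ a : Fin m → A, f ∘ a ∈ (systemMap (fun i => t (Pi.single i 1)) B).range →
        a ∈ (systemMap (fun i => t (Pi.single i 1)) A).range := by
  constructor
  · rintro h a ⟨b, hb⟩
    obtain ⟨l, hl⟩ := exists_linearMap_single_eq (R := R) b
    have hla (i : Fin m) : l (t (Pi.single i 1)) = f (a i) := by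
      rw [← systemMap_apply_of_linearMap, funext hl, hb]
      rfl
    have hglt : (g ∘ₗ l) ∘ₗ t = 0 := (Pi.basisFun R (Fin m)).ext fun i => by
      simp [hla, hfg.apply_apply_eq_zero]
    obtain ⟨u, hu⟩ := exists_comp_eq_of_surjective hq (h := g ∘ₗ l) fun x hx => by
      obtain ⟨y, rfl⟩ := (htq x).1 hx
      exact LinearMap.congr_fun hglt y
    obtain ⟨k, hk⟩ := h u
    obtain ⟨s, hs⟩ := exists_comp_eq_of_injective hf (h := l - k ∘ₗ q) fun x => (hfg _).1 (by
      have h1 : u (q x) = g (l x) := LinearMap.congr_fun hu x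
      have h2 : g (k (q x)) = u (q x) := LinearMap.congr_fun hk (q x)
      simp [h1, h2])
    refine ⟨fun j => s (Pi.single j 1), funext fun i => hf ?_⟩
    have h1 : f (s (t (Pi.single i 1))) = l (t (Pi.single i 1)) - k (q (t (Pi.single i 1))) :=
      LinearMap.congr_fun hs _
    rw [systemMap_apply_of_linearMap, h1, htq.apply_apply_eq_zero, map_zero, sub_zero, hla]
  · intro h u
    choose b hb using fun j : Fin n => hg (u (q (Pi.single j 1)))
    obtain ⟨l, hl⟩ := exists_linearMap_single_eq (R := R) b
    have hgl : g ∘ₗ l = u ∘ₗ q := (Pi.basisFun R (Fin n)).ext fun j => by simp [hl, hb]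
    have hgl' (x) : g (l x) = u (q x) := LinearMap.congr_fun hgl x
    choose a ha using fun i : Fin m => (hfg (l (t (Pi.single i 1)))).1 (by
      rw [hgl', htq.apply_apply_eq_zero, map_zero])
    obtain ⟨a', ha'⟩ := h a ⟨b, funext fun i => by
      rw [← funext hl, systemMap_apply_of_linearMap, Function.comp_apply, ha]⟩
    obtain ⟨l', hl'⟩ := exists_linearMap_single_eq (R := R) a'
    have hlt : (l - f ∘ₗ l') ∘ₗ t = 0 := (Pi.basisFun R (Fin m)).ext fun i => by
      have : l' (t (Pi.single i 1)) = a i := by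
        rw [← systemMap_apply_of_linearMap, funext hl', ha']
      simp [this, ha]
    obtain ⟨k, hk⟩ := exists_comp_eq_of_surjective hq (h := l - f ∘ₗ l') fun x hx => by
      obtain ⟨y, rfl⟩ := (htq x).1 hx
      exact LinearMap.congr_fun hlt y
    refine ⟨k, LinearMap.ext fun x => ?_⟩
    obtain ⟨y, rfl⟩ := hq x
    have h1 : k (q y) = l y - f (l' y) := LinearMap.congr_fun hk y
    simp [h1, hgl', hfg.apply_apply_eq_zero]

/-! ### Enough pure injective modules -/

/-- A reflecting matrix together with a character of `Mᵐ` annihilating the image of the matrix. -/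
structure ReflectingCharacter (S : Set (ModuleCat.{u} R)) (M : Type u) [AddCommGroup M]
    [Module R M] where
  rows : ℕ
  cols : ℕ
  matrix : Fin rows → Fin cols → R
  isReflecting : IsReflecting S matrix
  character : (Fin rows → M) →+ AddCircle (1 : ℚ)
  character_systemMap : ∀ b, character (systemMap matrix M b) = 0

/-- `M` embeds into the product of the modules `characterSolutions r` over all reflecting matrices
`r` and all characters of `Mᵐ / r Mⁿ`. These characters separate the points of `Mᵐ / r Mⁿ`, and
they all come from characters of `Eᵐ / r Eⁿ` for the product `E`, so the embedding is pure. -/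
theorem enoughPureInjectives (hfp : ∀ U ∈ S, Module.FinitePresentation R U) :
    EnoughPureInjectives S := by
  intro M
  let E : Type u := ∀ c : ReflectingCharacter S M, characterSolutions c.matrix
  let f : M →ₗ[R] E := LinearMap.pi fun c =>
    toCharacterSolutions c.matrix c.character c.character_systemMap
  have key (m n : ℕ) (r : Fin m → Fin n → R) (hr : IsReflecting S r) (a : Fin m → M)
      (ha : f ∘ a ∈ (systemMap r E).range) : a ∈ (systemMap r M).range := by
    by_contra hna
    obtain ⟨ψ, hψ, hψa⟩ := exists_addMonoidHom_ne_zero _ hna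
    obtain ⟨b, hb⟩ := ha
    let c : ReflectingCharacter S M := ⟨m, n, r, hr, ψ, fun b => hψ _ ⟨b, rfl⟩⟩
    have h1 := evalOne_systemMap r (LinearMap.proj c : E →ₗ[R] characterSolutions r) b
    rw [hb] at h1
    exact hψa ((evalOne_toCharacterSolutions r ψ c.character_systemMap a).symm.trans h1)
  have hf : Function.Injective f := (injective_iff_map_eq_zero f).2 fun a ha => by
    obtain ⟨b, hb⟩ := key 1 0 _ isReflecting_empty (fun _ => a) ⟨0, funext fun i => by
      simp [ha]⟩
    simpa using (congrFun hb 0).symm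
  refine ⟨ModuleCat.of R E, ModuleCat.of R (E ⧸ LinearMap.range f), f, (LinearMap.range f).mkQ,
    ⟨hf, LinearMap.exact_map_mkQ_range f, Submodule.mkQ_surjective _, fun U hU => ?_⟩,
    IsPureInjective.pi _ fun c => c.isReflecting.isPureInjective⟩
  have := hfp U hU
  obtain ⟨n, m, q, t, hq, htq⟩ := Module.FinitePresentation.exists_fin' R U
  refine (surjective_postcomp_iff_systemMap hq htq hf (LinearMap.exact_map_mkQ_range f)
    (Submodule.mkQ_surjective _)).2 (key m n _ fun A B C f g hfg => ?_)
  exact (surjective_postcomp_iff_systemMap hq htq hfg.1 hfg.2.1 hfg.2.2.1).1 (hfg.2.2.2 U hU)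

end Systems

end RelPurity

theorem corollary2p9 {R : Type u} [Ring R] (S : Set (ModuleCat.{u} R))
    (hfp : ∀ U ∈ S, Module.FinitePresentation R U)
    (hset : RelPurity.SetPresentable S)
    (hR : ModuleCat.of R R ∈ S) :
    RelPurity.HomRightBalanced (RelPurity.pureProjectives S) (RelPurity.pureInjectives S) ∧
    RelPurity.globalPureProjectiveDimension R S = RelPurity.globalPureInjectiveDimension R S :=
  have hP := RelPurity.enoughPureProjectives hset hR
  have hI := RelPurity.enoughPureInjectives hfp
  ⟨RelPurity.homRightBalanced hP hI, RelPurity.globalPureProjectiveDimension_eq hP hI⟩
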